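/- Let $k$ be a commutative ring with $1$; all algebras, linear maps and tensor products are over $k$. Let $\lambda,\kappa,\mu\in k$ with $\mu^2-\lambda\mu+\kappa=0$. **Conventions.** An *extended Rota-Baxter operator of weight $(\lambda,\kappa)$* on an algebra $R$ is a linear map $P:R\to R$ with $P(x)P(y)=P(xP(y))+P(P(x)y)+\lambda P(xy)+\kappa xy$ for all $x,y\in R$. A *filtered bialgebra* is a bialgebra $H$ with unit map $u:k\to H$, coproduct $\Delta$ and counit $\varepsilon$, together with submodules $H_n\subseteq H$ $(n\ge 0)$ such that $H_n\subseteq H_{n+1}$; $H=\bigcup_n H_n$; $H_pH_q\subseteq H_{p+q}$; $\Delta(H_n)\subseteq\sum_{p+q=n}H_p\otimes H_q$ (where $H_p\otimes H_q$ means its image in $H\otimes H$); and $H_n=\operatorname{im}u\oplus(H_n\cap\ker\varepsilon)$ for all $n$. It is *connected* if $H_0=\operatorname{im}u=k1_H$. For a commutative algebra $A$ let $Ш_e(A)=\bigoplus_{n\ge1}A^{\otimes n}$, with the operator $P(\mathfrak a)=1_A\otimes\mathfrak a$ and the bilinear product $\diamond$ given recursively on pure tensors by $$a\diamond b=ab,\qquad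 a\diamond(b\otimes\mathfrak b)=ab\otimes\mathfrak b,\qquad (a\otimes\mathfrak a)\diamond b=ab\otimes\mathfrak a,$$ $$(a\otimes\mathfrak a)\diamond(b\otimes\mathfrak b)=ab\otimes\big(\mathfrak a\diamond(1_A\otimes\mathfrak b)+(1_A\otimes\mathfrak a)\diamond\mathfrak b+\lambda\,\mathfrak a\diamond\mathfrak b\big)+\kappa\,ab\diamond(\mathfrak a\diamond\mathfrak b)$$ for $a,b\in A$ and pure tensors $\mathfrak a,\mathfrak b$ of length at least one. With the inclusion $j:A\to Ш_e(A)$ of the first summand, this is the free commutative extended Rota-Baxter algebra of weight $(\lambda,\kappa)$ on $A$. If $A$ is a commutative bialgebra, let $\varepsilon_e:Ш_e(A)\to k$ be the unique algebra homomorphism with $\varepsilon_e\circ j=\varepsilon_A$ and $\varepsilon_e\circ P=-\mu\,\varepsilon_e$, and let $\Delta_e:Ш_e(A)\to Ш_e(A)\otimes Ш_e(A)$ be the unique algebra homomorphism with $\Delta_e\circ j=(j\otimes j)\Delta_A$ and $\Delta_e\circ P=\bar P\circ\Delta_e$, where $$\bar P(\mathfrak a\otimes\mathfrak b)=P(\mathfrak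 a)\otimes\varepsilon_e(\mathfrak b)1+\mu\,\mathfrak a\otimes\varepsilon_e(\mathfrak b)1+\mathfrak a\otimes P(\mathfrak b).$$ **Theorem.** Let $A=\bigcup_{n\ge0}A_n$ be a commutative connected filtered bialgebra. For $a\in A$ put $\deg(a)=\min\{n\mid a\in A_n\}$, and let $Ш_e(A)_N$ be the submodule of $Ш_e(A)$ spanned by all pure tensors $a_0\otimes a_1\otimes\cdots\otimes a_m$ $(m\ge 0)$ with $\deg(a_0)+\cdots+\deg(a_m)+m\le N$. Then $Ш_e(A)$, with the product $\diamond$, the coproduct $\Delta_e$ and the counit $\varepsilon_e$, is a bialgebra, and the submodules $Ш_e(A)_N$ make it a connected filtered bialgebra. Hence it is a Hopf algebra, i.e. this bialgebra has an antipode. -/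

import Mathlib

open scoped TensorProduct DirectSum

universe u v w

/-- A `k`-linear operator `P` on a `k`-algebra `R` is an extended Rota-Baxter operator of
weight `(lam, kap)`. -/
def IsExtendedRotaBaxter {k : Type u} {R : Type v} [CommRing k] [Ring R] [Algebra k R]
    (lam kap : k) (P : R →ₗ[k] R) : Prop :=
  ∀ x y : R, P x * P y = P (x * P y) + P (P x * y) + lam • P (x * y) + kap • (x * y)

/-- The `k`-module `⨁_{n ≥ 0} A^{⊗ (n+1)}`. The weight `(lam, kap)` does not enter the module;
it is recorded in the type because the product depends on it. -/
def FreeERB (k : Type u) (A : Type v) [CommRing k] [CommRing A] [Algebra k A]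
    (_lam _kap : k) : Type (max u v) :=
  ⨁ n : ℕ, ⨂[k]^(n + 1) A

namespace FreeERB

noncomputable section

section Construction

variable {k : Type u} {A : Type v} [CommRing k] [CommRing A] [Algebra k A] {lam kap : k}

instance (priority := 50) instAddCommGroup : AddCommGroup (FreeERB k A lam kap) :=
  inferInstanceAs (AddCommGroup (⨁ n : ℕ, ⨂[k]^(n + 1) A))

instance (priority := 50) instModule : Module k (FreeERB k A lam kap) :=
  inferInstanceAs (Module k (⨁ n : ℕ, ⨂[k]^(n + 1) A))

/-! ### Tensors -/

/-- The inclusion of the summand `A^{⊗ (n+1)}`. -/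
def incl (n : ℕ) : ⨂[k]^(n + 1) A →ₗ[k] FreeERB k A lam kap :=
  DirectSum.lof k ℕ (fun n : ℕ => ⨂[k]^(n + 1) A) n

/-- The linear map out of the direct sum with prescribed components. -/
def desc {N : Type w} [AddCommMonoid N] [Module k N] (f : ∀ n : ℕ, ⨂[k]^(n + 1) A →ₗ[k] N) :
    FreeERB k A lam kap →ₗ[k] N :=
  DirectSum.toModule k ℕ N f

/-- The pure tensor `v 0 ⊗ v 1 ⊗ ⋯ ⊗ v n`. -/
def pure {n : ℕ} (v : Fin (n + 1) → A) : FreeERB k A lam kap :=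
  incl n (PiTensorProduct.tprod k v)

/-- `a ↦ (a_1 ⊗ ⋯ ⊗ a_{n+1} ↦ a ⊗ a_1 ⊗ ⋯ ⊗ a_{n+1})`. -/
def cons (n : ℕ) : A →ₗ[k] ⨂[k]^(n + 1) A →ₗ[k] ⨂[k]^(n + 2) A :=
  (PiTensorProduct.lift (R := k) (s := fun _ : Fin (n + 1) => A)).toLinearMap ∘ₗ
    (PiTensorProduct.tprod k (s := fun _ : Fin (n + 2) => A)).curryLeft

/-- The linear map `A^{⊗ (n+2)} → A ⊗ A^{⊗ (n+1)}` which splits off the first factor. -/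
def uncons (n : ℕ) : ⨂[k]^(n + 2) A →ₗ[k] A ⊗[k] ⨂[k]^(n + 1) A :=
  PiTensorProduct.lift (LinearMap.uncurryLeft (M := fun _ : Fin (n + 2) => A)
    ((PiTensorProduct.lift (R := k) (s := fun _ : Fin (n + 1) => A)).symm.toLinearMap ∘ₗ
      TensorProduct.mk k A (⨂[k]^(n + 1) A)))

/-- The action of `A` on the first factor, `b ↦ (a_0 ⊗ ⋯ ⊗ a_n ↦ (b * a_0) ⊗ ⋯ ⊗ a_n)`. -/
def act (n : ℕ) : A →ₗ[k] ⨂[k]^(n + 1) A →ₗ[k] ⨂[k]^(n + 1) A :=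
  PiTensorProduct.mul ∘ₗ
    (PiTensorProduct.tprod k (s := fun _ : Fin (n + 1) => A)).toLinearMap 1 0

/-- The identification of `A^{⊗ 1}` with `A`. -/
def single : ⨂[k]^1 A ≃ₗ[k] A :=
  PiTensorProduct.subsingletonEquiv (R := k) (s := fun _ : Fin 1 => A) 0

/-- `a ↦ (x ↦ a ⊗ x)` on the direct sum. -/
def consSum : A →ₗ[k] FreeERB k A lam kap →ₗ[k] FreeERB k A lam kap :=
  LinearMap.flip (desc fun n => LinearMap.flip ((cons n).compr₂ (incl (n + 1))))

/-- The action of `A` on the first factor, on the direct sum. -/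
def actSum : A →ₗ[k] FreeERB k A lam kap →ₗ[k] FreeERB k A lam kap :=
  LinearMap.flip (desc fun n => LinearMap.flip ((act n).compr₂ (incl n)))

/-- The embedding `a ↦ a` of `A` as the summand `A^{⊗ 1}`, as a linear map. -/
def embLin : A →ₗ[k] FreeERB k A lam kap := incl 0 ∘ₗ single.symm.toLinearMap

/-- The right-shift operator `x ↦ 1 ⊗ x`. -/
def P : FreeERB k A lam kap →ₗ[k] FreeERB k A lam kap := consSum 1

/-! ### The product -/

/-- The product of `A^{⊗ (m+1)}` and `A^{⊗ (n+1)}`: if `m = 0` or `n = 0` then the only factor of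
the one tensor multiplies the first factor of the other one, and
`(a ⊗ x)(b ⊗ y) = ab ⊗ (x (1 ⊗ y) + (1 ⊗ x) y + lam x y) + kap ab (x y)`.
See `pure_zero_mul_pure`, `pure_mul_pure_zero` and `consSum_mul_consSum`. -/
def mulAux : ∀ m n : ℕ, ⨂[k]^(m + 1) A →ₗ[k] ⨂[k]^(n + 1) A →ₗ[k] FreeERB k A lam kap
  | 0, n => ((act n).compr₂ (incl n)) ∘ₗ single.toLinearMap
  | m + 1, 0 => (((act (m + 1)).compr₂ (incl (m + 1))) ∘ₗ single.toLinearMap).flip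
  | m + 1, n + 1 =>
    ((TensorProduct.map₂ (LinearMap.mul k A)
        ((mulAux m (n + 1)).compl₂ (cons n 1) + mulAux (m + 1) n ∘ₗ cons m 1
          + lam • mulAux m n)).compr₂ (TensorProduct.lift consSum)
      + (TensorProduct.map₂ (LinearMap.mul k A) (mulAux m n)).compr₂
          (kap • TensorProduct.lift actSum)).compl₁₂ (uncons m) (uncons n)

/-- The product on the direct sum, as a bilinear map. -/
def mulLin : FreeERB k A lam kap →ₗ[k] FreeERB k A lam kap →ₗ[k] FreeERB k A lam kap :=
  desc fun m => LinearMap.flip (desc fun n => LinearMap.flip (mulAux m n))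

instance : Mul (FreeERB k A lam kap) := ⟨fun x y => mulLin x y⟩

instance : One (FreeERB k A lam kap) := ⟨embLin 1⟩

theorem mul_eq (x y : FreeERB k A lam kap) : x * y = mulLin x y := rfl

theorem one_eq : (1 : FreeERB k A lam kap) = embLin 1 := rfl

theorem cons_tprod (n : ℕ) (a : A) (v : Fin (n + 1) → A) :
    cons n a (PiTensorProduct.tprod k v) = PiTensorProduct.tprod k (Fin.cons a v : Fin (n + 2) → A) := by
  simp [cons]

theorem uncons_tprod (n : ℕ) (v : Fin (n + 2) → A) :
    uncons n (PiTensorProduct.tprod k v)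
      = v 0 ⊗ₜ[k] PiTensorProduct.tprod k (fun i : Fin (n + 1) => v i.succ) := by
  simp [uncons, PiTensorProduct.lift_symm]
  rfl

theorem act_tprod (n : ℕ) (a : A) (v : Fin (n + 1) → A) :
    act n a (PiTensorProduct.tprod k v)
      = PiTensorProduct.tprod k (Function.update v 0 (a * v 0)) := by
  simp [act]
  congr 1
  ext i
  by_cases h : i = 0
  · subst h; simp
  · simp [h]

theorem single_tprod (v : Fin 1 → A) : single (PiTensorProduct.tprod k v) = v 0 := by
  simp [single]

theorem single_symm (a : A) :
    (single (k := k)).symm a = PiTensorProduct.tprod k (fun _ : Fin 1 => a) := by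
  rw [LinearEquiv.symm_apply_eq, single_tprod]

@[simp] theorem desc_incl {N : Type w} [AddCommMonoid N] [Module k N]
    (f : ∀ n : ℕ, ⨂[k]^(n + 1) A →ₗ[k] N) (n : ℕ) (x : ⨂[k]^(n + 1) A) :
    desc (lam := lam) (kap := kap) f (incl n x) = f n x :=
  DirectSum.toModule_lof (M := fun n : ℕ => ⨂[k]^(n + 1) A) k (φ := f) n x

@[simp] theorem consSum_incl (n : ℕ) (a : A) (x : ⨂[k]^(n + 1) A) :
    consSum (lam := lam) (kap := kap) a (incl n x) = incl (n + 1) (cons n a x) := by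
  simp [consSum]

@[simp] theorem actSum_incl (n : ℕ) (a : A) (x : ⨂[k]^(n + 1) A) :
    actSum (lam := lam) (kap := kap) a (incl n x) = incl n (act n a x) := by
  simp [actSum]

@[simp] theorem mulLin_incl (m n : ℕ) (x : ⨂[k]^(m + 1) A) (y : ⨂[k]^(n + 1) A) :
    mulLin (lam := lam) (kap := kap) (incl m x) (incl n y) = mulAux m n x y := by
  simp [mulLin]

theorem pure_zero (v : Fin 1 → A) :
    (pure v : FreeERB k A lam kap) = embLin (v 0) := by
  simp only [pure, embLin, LinearMap.comp_apply, LinearEquiv.coe_coe, single_symm]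
  congr 2
  ext i
  rw [Subsingleton.elim i 0]

theorem pure_succ {n : ℕ} (v : Fin (n + 2) → A) :
    (pure v : FreeERB k A lam kap) = consSum (v 0) (pure fun i : Fin (n + 1) => v i.succ) := by
  simp only [pure, consSum_incl, cons_tprod]
  congr 2
  exact (Fin.cons_self_tail v).symm

theorem P_pure {n : ℕ} (v : Fin (n + 1) → A) :
    P (pure v : FreeERB k A lam kap) = pure (Fin.cons 1 v : Fin (n + 2) → A) := by
  rw [pure_succ]; rfl

theorem linearMap_ext_incl {N : Type w} [AddCommMonoid N] [Module k N]
    {f g : FreeERB k A lam kap →ₗ[k] N} (h : ∀ n t, f (incl n t) = g (incl n t)) : f = g :=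
  DirectSum.linearMap_ext (M := fun n : ℕ => ⨂[k]^(n + 1) A) k
    fun n => LinearMap.ext fun t => h n t

theorem linearMap_ext_pure {N : Type w} [AddCommMonoid N] [Module k N]
    {f g : FreeERB k A lam kap →ₗ[k] N}
    (h : ∀ n (v : Fin (n + 1) → A), f (pure v) = g (pure v)) : f = g := by
  refine linearMap_ext_incl fun n t => ?_
  have : f ∘ₗ incl n = g ∘ₗ incl n := PiTensorProduct.ext (MultilinearMap.ext fun v => h n v)
  exact LinearMap.congr_fun this t

/-- Inductive description of the pure tensors with `n + 1` factors. -/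
inductive IsPure : ℕ → FreeERB k A lam kap → Prop
  | emb (a : A) : IsPure 0 (embLin a)
  | cons (n : ℕ) (a : A) (x : FreeERB k A lam kap) : IsPure n x → IsPure (n + 1) (consSum a x)

theorem isPure_pure : ∀ {n : ℕ} (v : Fin (n + 1) → A), IsPure n (pure v : FreeERB k A lam kap)
  | 0, v => by rw [pure_zero]; exact .emb _
  | _ + 1, v => by rw [pure_succ]; exact .cons _ _ _ (isPure_pure _)

theorem linearMap_ext {N : Type w} [AddCommMonoid N] [Module k N]
    {f g : FreeERB k A lam kap →ₗ[k] N} (h : ∀ n x, IsPure n x → f x = g x) : f = g :=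
  linearMap_ext_pure fun n v => h n _ (isPure_pure v)

/-! ### The recursion for the product, and the ring axioms -/

@[simp] theorem actSum_embLin (a b : A) :
    actSum (lam := lam) (kap := kap) a (embLin b : FreeERB k A lam kap) = embLin (a * b) := by
  simp only [embLin, LinearMap.comp_apply, LinearEquiv.coe_coe, single_symm, actSum_incl, act_tprod]
  congr 2
  ext i
  have hi : i = 0 := Fin.fin_one_eq_zero i
  subst hi
  simp

@[simp] theorem actSum_consSum (a b : A) (x : FreeERB k A lam kap) :
    actSum a (consSum b x) = consSum (a * b) x := by
  have : (actSum a) ∘ₗ (consSum b) = consSum (lam := lam) (kap := kap) (k := k) (a * b) := by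
    refine linearMap_ext_pure fun n v => ?_
    simp only [pure, LinearMap.comp_apply, consSum_incl, actSum_incl, cons_tprod, act_tprod]
    simp
  exact LinearMap.congr_fun this x

@[simp] theorem actSum_actSum (a b : A) (x : FreeERB k A lam kap) :
    actSum a (actSum b x) = actSum (a * b) x := by
  have : (actSum a) ∘ₗ (actSum b) = actSum (lam := lam) (kap := kap) (k := k) (a * b) := by
    refine linearMap_ext fun n x hx => ?_
    cases hx <;> simp [mul_assoc]
  exact LinearMap.congr_fun this x

@[simp] theorem actSum_one (x : FreeERB k A lam kap) : actSum 1 x = x := by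
  have : actSum 1 = (LinearMap.id : FreeERB k A lam kap →ₗ[k] FreeERB k A lam kap) := by
    refine linearMap_ext fun n x hx => ?_
    cases hx <;> simp
  exact LinearMap.congr_fun this x

theorem mulLin_embLin (a : A) (x : FreeERB k A lam kap) : mulLin (embLin a) x = actSum a x := by
  have : mulLin (embLin a) = actSum (lam := lam) (kap := kap) (k := k) a := by
    refine linearMap_ext_incl fun n t => ?_
    simp [embLin, mulAux]
  exact LinearMap.congr_fun this x

theorem mulLin_embLin_right (a : A) (x : FreeERB k A lam kap) :
    mulLin x (embLin a) = actSum a x := by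
  have : mulLin.flip (embLin a) = actSum (lam := lam) (kap := kap) (k := k) a := by
    refine linearMap_ext fun n x hx => ?_
    cases hx with
    | emb b => simp [mulLin_embLin, mul_comm]
    | cons n b x hx =>
      have : (mulLin.flip (embLin a)) ∘ₗ consSum b
          = actSum (lam := lam) (kap := kap) (k := k) a ∘ₗ consSum b := by
        refine linearMap_ext_incl fun n t => ?_
        simp [embLin, mulAux]
      exact LinearMap.congr_fun this x
  exact LinearMap.congr_fun this x

theorem mulLin_consSum (a b : A) (x y : FreeERB k A lam kap) :
    mulLin (consSum a x) (consSum b y)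
      = consSum (a * b) (mulLin x (P y) + mulLin (P x) y + lam • mulLin x y)
        + kap • actSum (a * b) (mulLin x y) := by
  have : (mulLin (lam := lam) (kap := kap)).compl₁₂ (consSum a) (consSum b)
      = (mulLin.compl₂ P + mulLin ∘ₗ P + lam • mulLin).compr₂ (consSum (k := k) (a * b))
        + kap • mulLin.compr₂ (actSum (a * b)) := by
    refine linearMap_ext_pure fun m v => linearMap_ext_pure fun n w => ?_
    simp [pure, P, mulAux, cons_tprod, uncons_tprod]
  simpa using LinearMap.congr_fun (LinearMap.congr_fun this x) y

theorem mulLin_comm (x y : FreeERB k A lam kap) : mulLin x y = mulLin y x := by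
  have key : ∀ N : ℕ, ∀ m n (x y : FreeERB k A lam kap), IsPure m x → IsPure n y → m + n ≤ N →
      mulLin x y = mulLin y x := by
    intro N
    induction N with
    | zero =>
      intro m n x y hx hy h
      cases hx with
      | emb a => rw [mulLin_embLin, mulLin_embLin_right]
      | cons m a x hx => omega
    | succ N ih =>
      intro m n x y hx hy h
      cases hx with
      | emb a => rw [mulLin_embLin, mulLin_embLin_right]
      | cons m a x hx =>
        cases hy with
        | emb b => rw [mulLin_embLin, mulLin_embLin_right]
        | cons n b y hy =>
          rw [mulLin_consSum, mulLin_consSum, ih _ _ x (P y) hx (.cons _ _ _ hy) (by omega),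
            ih _ _ (P x) y (.cons _ _ _ hx) hy (by omega), ih _ _ x y hx hy (by omega),
            mul_comm a b, add_comm (mulLin (P y) x)]
  have : mulLin (lam := lam) (kap := kap) (k := k) (A := A) = mulLin.flip := by
    refine linearMap_ext fun m x hx => linearMap_ext fun n y hy => ?_
    exact key _ m n x y hx hy le_rfl
  exact LinearMap.congr_fun (LinearMap.congr_fun this x) y

theorem actSum_mulLin (a : A) (x y : FreeERB k A lam kap) :
    mulLin (actSum a x) y = actSum a (mulLin x y) := by
  have : mulLin (lam := lam) (kap := kap) (k := k) (A := A) ∘ₗ actSum a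
      = mulLin.compr₂ (actSum a) := by
    refine linearMap_ext fun m x hx => linearMap_ext fun n y hy => ?_
    cases hx with
    | emb b => simp [mulLin_embLin]
    | cons m b x hx =>
      cases hy with
      | emb c => simp [mulLin_embLin_right, mul_left_comm]
      | cons n c y hy => simp [mulLin_consSum, mul_assoc]
  exact LinearMap.congr_fun (LinearMap.congr_fun this x) y

theorem actSum_mulLin_right (a : A) (x y : FreeERB k A lam kap) :
    mulLin x (actSum a y) = actSum a (mulLin x y) := by
  rw [mulLin_comm, actSum_mulLin, mulLin_comm]

theorem mulLin_assoc (x y z : FreeERB k A lam kap) :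
    mulLin (mulLin x y) z = mulLin x (mulLin y z) := by
  have key : ∀ N : ℕ, ∀ m n r (x y z : FreeERB k A lam kap), IsPure m x → IsPure n y →
      IsPure r z → m + n + r ≤ N → mulLin (mulLin x y) z = mulLin x (mulLin y z) := by
    intro N
    induction N with
    | zero =>
      intro m n r x y z hx hy hz h
      cases hx with
      | emb a => rw [mulLin_embLin, mulLin_embLin, actSum_mulLin]
      | cons m a x hx => omega
    | succ N ih =>
      intro m n r x y z hx hy hz h
      cases hx with
      | emb a => rw [mulLin_embLin, mulLin_embLin, actSum_mulLin]
      | cons m a x hx =>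
      cases hy with
      | emb b => rw [mulLin_embLin_right, mulLin_embLin, actSum_mulLin, actSum_mulLin_right]
      | cons n b y hy =>
      cases hz with
      | emb c => rw [mulLin_embLin_right, mulLin_embLin_right, actSum_mulLin_right]
      | cons r c z hz =>
        have hPx : IsPure (m + 1) (P x) := .cons _ _ _ hx
        have hPy : IsPure (n + 1) (P y) := .cons _ _ _ hy
        have hPz : IsPure (r + 1) (P z) := .cons _ _ _ hz
        have PP : ∀ s t : FreeERB k A lam kap, mulLin (P s) (P t)
            = P (mulLin s (P t)) + P (mulLin (P s) t) + lam • P (mulLin s t)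
              + kap • mulLin s t := by
          intro s t
          have := mulLin_consSum (1 : A) 1 s t
          simpa [P] using this
        have hax : consSum a x = actSum a (P x) := by rw [P, actSum_consSum, mul_one]
        have hcz : consSum c z = actSum c (P z) := by rw [P, actSum_consSum, mul_one]
        have h1 := ih _ _ _ x (P y) (P z) hx hPy hPz (by omega)
        have h2 := ih _ _ _ (P x) y (P z) hPx hy hPz (by omega)
        have h3 := ih _ _ _ (P x) (P y) z hPx hPy hz (by omega)
        have h4 := ih _ _ _ x y (P z) hx hy hPz (by omega)
        have h5 := ih _ _ _ x (P y) z hx hPy hz (by omega)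
        have h6 := ih _ _ _ (P x) y z hPx hy hz (by omega)
        have h7 := ih _ _ _ x y z hx hy hz (by omega)
        rw [PP] at h1 h3
        simp only [map_add, map_smul, LinearMap.add_apply, LinearMap.smul_apply] at h1 h3
        simp only [mulLin_consSum, map_add, map_smul, LinearMap.add_apply, LinearMap.smul_apply,
          actSum_mulLin, actSum_mulLin_right, mul_assoc, h1, h2, ← h3, h4, h5, h6, h7]
        rw [hax, hcz]
        simp only [actSum_mulLin, actSum_mulLin_right, actSum_actSum, mul_comm c,
          mul_left_comm _ a, h4, mul_assoc]
        module
  have h1 : mulLin.flip z ∘ₗ mulLin.flip y = mulLin.flip (mulLin y z) := by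
    refine linearMap_ext fun m x hx => ?_
    have h2 : mulLin.flip z ∘ₗ mulLin x = mulLin x ∘ₗ mulLin.flip z := by
      refine linearMap_ext fun n y hy => ?_
      have h3 : mulLin (mulLin x y) = mulLin x ∘ₗ mulLin y :=
        linearMap_ext fun r z hz => key _ m n r x y z hx hy hz le_rfl
      exact LinearMap.congr_fun h3 z
    exact LinearMap.congr_fun h2 y
  exact LinearMap.congr_fun h1 x

instance instCommRing : CommRing (FreeERB k A lam kap) where
  __ := (inferInstance : AddCommGroup (FreeERB k A lam kap))
  mul := (· * ·)
  one := 1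
  mul_assoc := mulLin_assoc
  mul_comm := mulLin_comm
  one_mul x := by rw [mul_eq, one_eq, mulLin_embLin, actSum_one]
  mul_one x := by rw [mul_eq, one_eq, mulLin_embLin_right, actSum_one]
  left_distrib x y z := by simp [mul_eq]
  right_distrib x y z := by simp [mul_eq]
  zero_mul x := by simp [mul_eq]
  mul_zero x := by simp [mul_eq]

instance instAlgebra : Algebra k (FreeERB k A lam kap) :=
  Algebra.ofModule (fun c x y => by simp [mul_eq]) (fun c x y => by simp [mul_eq])

/-- The embedding `A → FreeERB k A lam kap` as an algebra homomorphism. -/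
def emb : A →ₐ[k] FreeERB k A lam kap :=
  AlgHom.ofLinearMap embLin rfl (fun a b => by rw [mul_eq, mulLin_embLin, actSum_embLin])

theorem emb_apply (a : A) : (emb a : FreeERB k A lam kap) = pure (fun _ : Fin 1 => a) := by
  rw [pure_zero]; rfl

theorem emb_mul (a : A) (x : FreeERB k A lam kap) : emb a * x = actSum a x := mulLin_embLin a x

theorem consSum_eq (a : A) (x : FreeERB k A lam kap) : consSum a x = emb a * P x := by
  rw [emb_mul, P, actSum_consSum, mul_one]

theorem pure_zero_mul_pure {n : ℕ} (a : A) (v : Fin (n + 1) → A) :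
    (pure (fun _ : Fin 1 => a) * pure v : FreeERB k A lam kap)
      = pure (Function.update v 0 (a * v 0)) := by
  rw [← emb_apply, emb_mul, pure, actSum_incl, act_tprod]; rfl

theorem pure_mul_pure_zero {n : ℕ} (a : A) (v : Fin (n + 1) → A) :
    (pure v * pure (fun _ : Fin 1 => a) : FreeERB k A lam kap)
      = pure (Function.update v 0 (a * v 0)) := by
  rw [mul_comm, pure_zero_mul_pure]

theorem consSum_mul_consSum (a b : A) (x y : FreeERB k A lam kap) :
    consSum a x * consSum b y
      = consSum (a * b) (x * consSum 1 y + consSum 1 x * y + lam • (x * y))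
        + kap • (emb (a * b) * (x * y)) := by
  rw [emb_mul]; exact mulLin_consSum a b x y

theorem isExtendedRotaBaxter_P :
    IsExtendedRotaBaxter lam kap (P : FreeERB k A lam kap →ₗ[k] FreeERB k A lam kap) := by
  intro x y
  have := consSum_mul_consSum 1 1 x y
  simpa [P] using this

/-! ### The universal property -/

/-- The components of the lift of `f`: `a ↦ f a` and `a ⊗ x ↦ f a * Q (lift x)`. -/
def liftAux {R : Type w} [CommRing R] [Algebra k R] (f : A →ₐ[k] R) (Q : R →ₗ[k] R) :
    ∀ n : ℕ, ⨂[k]^(n + 1) A →ₗ[k] R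
  | 0 => f.toLinearMap ∘ₗ single.toLinearMap
  | n + 1 => TensorProduct.lift
      ((LinearMap.mul k R).compl₁₂ f.toLinearMap (Q ∘ₗ liftAux f Q n)) ∘ₗ uncons n

/-- The lift of `f` as a linear map. -/
def liftLin {R : Type w} [CommRing R] [Algebra k R] (f : A →ₐ[k] R) (Q : R →ₗ[k] R) :
    FreeERB k A lam kap →ₗ[k] R :=
  desc (liftAux f Q)

section lift

variable {R : Type w} [CommRing R] [Algebra k R] (f : A →ₐ[k] R) (Q : R →ₗ[k] R)

@[simp] theorem liftLin_embLin (a : A) :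
    liftLin (lam := lam) (kap := kap) f Q (embLin a) = f a := by
  simp [liftLin, embLin, liftAux]

@[simp] theorem liftLin_consSum (a : A) (x : FreeERB k A lam kap) :
    liftLin f Q (consSum a x) = f a * Q (liftLin f Q x) := by
  have : liftLin f Q ∘ₗ consSum a
      = LinearMap.mul k R (f a) ∘ₗ Q ∘ₗ liftLin (lam := lam) (kap := kap) f Q := by
    refine linearMap_ext_pure fun n v => ?_
    simp [pure, liftLin, liftAux, cons_tprod, uncons_tprod]
  exact LinearMap.congr_fun this x

theorem liftLin_actSum (a : A) (x : FreeERB k A lam kap) :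
    liftLin f Q (actSum a x) = f a * liftLin f Q x := by
  have : liftLin f Q ∘ₗ actSum a
      = LinearMap.mul k R (f a) ∘ₗ liftLin (lam := lam) (kap := kap) f Q := by
    refine linearMap_ext fun n x hx => ?_
    cases hx <;> simp [mul_assoc]
  exact LinearMap.congr_fun this x

theorem liftLin_mul (hQ : IsExtendedRotaBaxter lam kap Q) (x y : FreeERB k A lam kap) :
    liftLin f Q (mulLin x y) = liftLin f Q x * liftLin f Q y := by
  have key : ∀ N : ℕ, ∀ m n (x y : FreeERB k A lam kap), IsPure m x → IsPure n y → m + n ≤ N →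
      liftLin f Q (mulLin x y) = liftLin f Q x * liftLin f Q y := by
    intro N
    induction N with
    | zero =>
      intro m n x y hx hy h
      cases hx with
      | emb a => rw [mulLin_embLin, liftLin_actSum, liftLin_embLin]
      | cons m a x hx => omega
    | succ N ih =>
      intro m n x y hx hy h
      cases hx with
      | emb a => rw [mulLin_embLin, liftLin_actSum, liftLin_embLin]
      | cons m a x hx =>
        cases hy with
        | emb b => rw [mulLin_embLin_right, liftLin_actSum, liftLin_embLin, mul_comm]
        | cons n b y hy =>
          have h1 := ih _ _ x (P y) hx (.cons _ _ _ hy) (by omega)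
          have h2 := ih _ _ (P x) y (.cons _ _ _ hx) hy (by omega)
          have h3 := ih _ _ x y hx hy (by omega)
          have hP : ∀ z : FreeERB k A lam kap, liftLin f Q (P z) = Q (liftLin f Q z) := by
            intro z; simp [P]
          rw [hP] at h1 h2
          have h4 := hQ (liftLin f Q x) (liftLin f Q y)
          simp only [mulLin_consSum, map_add, map_smul, liftLin_consSum, liftLin_actSum, h1, h2,
            h3, map_mul]
          rw [mul_mul_mul_comm (f a) (Q _), h4]
          simp only [mul_add, mul_smul_comm]
  have : (mulLin (lam := lam) (kap := kap)).compr₂ (liftLin f Q)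
      = (LinearMap.mul k R).compl₁₂ (liftLin f Q) (liftLin f Q) := by
    refine linearMap_ext fun m x hx => linearMap_ext fun n y hy => ?_
    exact key _ m n x y hx hy le_rfl
  exact LinearMap.congr_fun (LinearMap.congr_fun this x) y

/-- The homomorphism of extended Rota-Baxter algebras `FreeERB k A lam kap → (R, Q)` induced by an
algebra homomorphism `f : A → R`. -/
def lift (hQ : IsExtendedRotaBaxter lam kap Q) : FreeERB k A lam kap →ₐ[k] R :=
  AlgHom.ofLinearMap (liftLin f Q) (by rw [one_eq, liftLin_embLin, map_one])
    (liftLin_mul f Q hQ)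

theorem lift_emb (hQ : IsExtendedRotaBaxter lam kap Q) (a : A) : lift f Q hQ (emb a) = f a :=
  liftLin_embLin (lam := lam) (kap := kap) f Q a

theorem lift_P (hQ : IsExtendedRotaBaxter lam kap Q) (x : FreeERB k A lam kap) :
    lift f Q hQ (P x) = Q (lift f Q hQ x) := by
  have := liftLin_consSum (lam := lam) (kap := kap) f Q 1 x
  rwa [map_one f, one_mul] at this

/-- Together with `isExtendedRotaBaxter_P`, `lift_emb` and `lift_P`, this is the universal property
of the free commutative extended Rota-Baxter algebra on `A`. -/
theorem lift_unique (hQ : IsExtendedRotaBaxter lam kap Q) (g : FreeERB k A lam kap →ₐ[k] R)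
    (hg : ∀ a, g (emb a) = f a) (hgP : ∀ x, g (P x) = Q (g x)) : g = lift f Q hQ := by
  have : g.toLinearMap = (lift f Q hQ).toLinearMap := by
    refine linearMap_ext fun n x hx => ?_
    induction hx with
    | emb a => exact (hg a).trans (lift_emb f Q hQ a).symm
    | cons n a x hx ih =>
      simp only [AlgHom.toLinearMap_apply] at ih ⊢
      rw [consSum_eq, map_mul, map_mul, hg, hgP, lift_emb, lift_P, ih]
  exact AlgHom.toLinearMap_injective this

end lift

end Construction

/-! ### The counit and the coproduct -/

section Bialgebra

variable {k : Type u} {A : Type v} [CommRing k] [CommRing A] [Bialgebra k A] {lam kap mu : k}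

theorem isExtendedRotaBaxter_neg_smul (hmu : mu ^ 2 - lam * mu + kap = 0) :
    IsExtendedRotaBaxter lam kap (-mu • (LinearMap.id : k →ₗ[k] k)) := by
  intro x y
  simp only [LinearMap.smul_apply, LinearMap.id_apply, smul_eq_mul]
  linear_combination (-(x * y)) * hmu

/-- The counit: the unique homomorphism of extended Rota-Baxter algebras to `(k, -mu • id)` which
restricts to the counit of `A`. -/
def counit (hmu : mu ^ 2 - lam * mu + kap = 0) : FreeERB k A lam kap →ₐ[k] k :=
  lift (Bialgebra.counitAlgHom k A) (-mu • LinearMap.id) (isExtendedRotaBaxter_neg_smul hmu)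

/-- The operator `x ⊗ y ↦ P x ⊗ ε(y) 1 + mu x ⊗ ε(y) 1 + x ⊗ P y`. -/
def Pbar (hmu : mu ^ 2 - lam * mu + kap = 0) :
    FreeERB k A lam kap ⊗[k] FreeERB k A lam kap →ₗ[k]
      FreeERB k A lam kap ⊗[k] FreeERB k A lam kap :=
  TensorProduct.map P (Algebra.linearMap k _ ∘ₗ (counit hmu).toLinearMap)
    + mu • TensorProduct.map LinearMap.id (Algebra.linearMap k _ ∘ₗ (counit hmu).toLinearMap)
    + TensorProduct.map LinearMap.id P

theorem Pbar_tmul (hmu : mu ^ 2 - lam * mu + kap = 0) (x y : FreeERB k A lam kap) :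
    Pbar hmu (x ⊗ₜ y) = P x ⊗ₜ algebraMap k _ (counit hmu y)
      + mu • (x ⊗ₜ algebraMap k _ (counit hmu y)) + x ⊗ₜ P y := rfl

theorem isExtendedRotaBaxter_Pbar (hmu : mu ^ 2 - lam * mu + kap = 0) :
    IsExtendedRotaBaxter lam kap (Pbar (A := A) hmu) := by
  intro s t
  induction s using TensorProduct.induction_on with
  | zero => simp
  | add s s' hs hs' =>
    simp only [map_add, add_mul, smul_add, hs, hs']
    abel
  | tmul a b =>
  induction t using TensorProduct.induction_on with
  | zero => simp
  | add t t' ht ht' =>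
    simp only [map_add, mul_add, smul_add, ht, ht']
    abel
  | tmul c d =>
    have hε : ∀ z : FreeERB k A lam kap, counit hmu (P z) = -mu * counit hmu z :=
      fun z => lift_P _ _ _ z
    simp only [Pbar_tmul, mul_add, add_mul, Algebra.TensorProduct.tmul_mul_tmul, map_add, map_smul,
      map_mul, hε, Algebra.algebraMap_eq_smul_one, Algebra.mul_smul_comm, Algebra.smul_mul_assoc,
      isExtendedRotaBaxter_P _ _, TensorProduct.tmul_smul, TensorProduct.tmul_add, one_mul, mul_one,
      TensorProduct.add_tmul, smul_add, smul_smul, ← TensorProduct.smul_tmul']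
    have h0 : (mu ^ 2 - lam * mu + kap) • ((a * c) ⊗ₜ[k] (1 : FreeERB k A lam kap)) = 0 := by
      rw [hmu, zero_smul]
    rw [← sub_eq_zero, ← smul_zero (counit hmu b * counit hmu d), ← h0]
    module

/-- The coproduct: the unique homomorphism of extended Rota-Baxter algebras to
`FreeERB k A lam kap ⊗ FreeERB k A lam kap`, with the operator `Pbar`, which restricts to the
coproduct of `A`. -/
def comul (hmu : mu ^ 2 - lam * mu + kap = 0) :
    FreeERB k A lam kap →ₐ[k] FreeERB k A lam kap ⊗[k] FreeERB k A lam kap :=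
  lift ((Algebra.TensorProduct.map emb emb).comp (Bialgebra.comulAlgHom k A)) (Pbar hmu)
    (isExtendedRotaBaxter_Pbar hmu)

end Bialgebra

/-! ### The filtration -/

section Filtration

variable {k : Type u} {A : Type v} [CommRing k] [CommRing A] [Algebra k A]

/-- The degree of `a` with respect to `F`: the least `n` with `a ∈ F n`. -/
def deg (F : ℕ → Submodule k A) (a : A) : ℕ := sInf {n | a ∈ F n}

/-- The submodule spanned by the pure tensors `v 0 ⊗ ⋯ ⊗ v m` with
`deg (v 0) + ⋯ + deg (v m) + m ≤ N`. -/
def filtration (lam kap : k) (F : ℕ → Submodule k A) (N : ℕ) :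
    Submodule k (FreeERB k A lam kap) :=
  Submodule.span k {x | ∃ (m : ℕ) (v : Fin (m + 1) → A),
    (∑ i, deg F (v i)) + m ≤ N ∧ x = pure v}

end Filtration

end

end FreeERB

/-- The coalgebra axioms for a coproduct and a counit which are algebra homomorphisms, that is, the
axioms which make the algebra `H` a bialgebra. -/
structure IsBialgebraStructure {k : Type u} {H : Type v} [CommRing k] [Ring H] [Algebra k H]
    (Δ : H →ₐ[k] H ⊗[k] H) (ε : H →ₐ[k] k) : Prop where
  coassoc : (Algebra.TensorProduct.assoc k k k H H H).toAlgHom.comp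
      ((Algebra.TensorProduct.map Δ (.id k H)).comp Δ)
    = (Algebra.TensorProduct.map (.id k H) Δ).comp Δ
  counit_left : (Algebra.TensorProduct.map ε (.id k H)).comp Δ
    = (Algebra.TensorProduct.lid k H).symm
  counit_right : (Algebra.TensorProduct.map (.id k H) ε).comp Δ
    = (Algebra.TensorProduct.rid k k H).symm

/-- The bialgebra with the given algebra `H`, coproduct `Δ` and counit `ε`. -/
abbrev IsBialgebraStructure.toBialgebra {k : Type u} {H : Type v} [CommRing k] [Ring H]
    [Algebra k H] {Δ : H →ₐ[k] H ⊗[k] H} {ε : H →ₐ[k] k} (h : IsBialgebraStructure Δ ε) :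
    Bialgebra k H :=
  Bialgebra.ofAlgHom Δ ε h.coassoc h.counit_left h.counit_right

/-- `F` makes the bialgebra `H` an (increasing) filtered bialgebra. For submodules `M`, `N` of `H`,
the range of `M ⊗ N → H ⊗ H` is what is usually written `M ⊗ N ⊆ H ⊗ H`. -/
structure IsFilteredBialgebra (k : Type u) (H : Type v) [CommRing k] [Ring H] [Bialgebra k H]
    (F : ℕ → Submodule k H) : Prop where
  le_succ : ∀ n, F n ≤ F (n + 1)
  exhaustive : ∀ x : H, ∃ n, x ∈ F n
  mul_mem : ∀ p q, ∀ x ∈ F p, ∀ y ∈ F q, x * y ∈ F (p + q)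
  comul_mem : ∀ n, ∀ x ∈ F n, Coalgebra.comul (R := k) x ∈
    ⨆ (p : ℕ) (q : ℕ) (_ : p + q = n),
      LinearMap.range (TensorProduct.map (F p).subtype (F q).subtype)
  sup_eq : ∀ n, LinearMap.range (Algebra.linearMap k H)
    ⊔ (F n ⊓ LinearMap.ker (Coalgebra.counit (R := k) (A := H))) = F n
  disjoint : ∀ n, Disjoint (LinearMap.range (Algebra.linearMap k H))
    (F n ⊓ LinearMap.ker (Coalgebra.counit (R := k) (A := H)))

/-- `F` makes the bialgebra `H` a connected filtered bialgebra. -/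
structure IsConnectedFilteredBialgebra (k : Type u) (H : Type v) [CommRing k] [Ring H]
    [Bialgebra k H] (F : ℕ → Submodule k H) : Prop extends IsFilteredBialgebra k H F where
  connected : F 0 = LinearMap.range (Algebra.linearMap k H)

section TensorFiltration

variable {k : Type u} {H : Type v} [CommRing k]

/-- The submodule `∑_{p + q = n} F p ⊗ F q` of `H ⊗ H`. -/
abbrev tensorFiltration [AddCommGroup H] [Module k H] (F : ℕ → Submodule k H) (n : ℕ) :
    Submodule k (H ⊗[k] H) :=
  ⨆ (p : ℕ) (q : ℕ) (_ : p + q = n), LinearMap.range (TensorProduct.map (F p).subtype (F q).subtype)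

theorem tmul_mem_tensorFiltration [AddCommGroup H] [Module k H] {F : ℕ → Submodule k H}
    {p q n : ℕ} (h : p + q = n) {x y : H} (hx : x ∈ F p) (hy : y ∈ F q) :
    x ⊗ₜ[k] y ∈ tensorFiltration F n := by
  have : x ⊗ₜ[k] y ∈ LinearMap.range (TensorProduct.map (F p).subtype (F q).subtype) :=
    ⟨(⟨x, hx⟩ : F p) ⊗ₜ (⟨y, hy⟩ : F q), rfl⟩
  exact (le_iSup_of_le p <| le_iSup_of_le q <| le_iSup_of_le h le_rfl :
    LinearMap.range (TensorProduct.map (F p).subtype (F q).subtype) ≤ tensorFiltration F n) this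

theorem tensorFiltration_le [AddCommGroup H] [Module k H] {F : ℕ → Submodule k H} {n : ℕ}
    {M : Submodule k (H ⊗[k] H)}
    (h : ∀ p q, p + q = n → ∀ x ∈ F p, ∀ y ∈ F q, x ⊗ₜ[k] y ∈ M) : tensorFiltration F n ≤ M := by
  refine iSup_le fun p => iSup_le fun q => iSup_le fun hpq => ?_
  rintro _ ⟨t, rfl⟩
  induction t using TensorProduct.induction_on with
  | zero => simp
  | add s t hs ht => rw [map_add]; exact M.add_mem hs ht
  | tmul x y => exact h p q hpq x x.2 y y.2

theorem mul_mem_tensorFiltration [Ring H] [Algebra k H] {F : ℕ → Submodule k H}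
    (hF : ∀ p q, ∀ x ∈ F p, ∀ y ∈ F q, x * y ∈ F (p + q)) {m n : ℕ} {s t : H ⊗[k] H}
    (hs : s ∈ tensorFiltration F m) (ht : t ∈ tensorFiltration F n) :
    s * t ∈ tensorFiltration F (m + n) := by
  have h1 : tensorFiltration F m ≤
      (tensorFiltration F (m + n)).comap (LinearMap.mulRight k t) := by
    refine tensorFiltration_le fun p q hpq x hx y hy => ?_
    have h2 : tensorFiltration F n ≤
        (tensorFiltration F (m + n)).comap (LinearMap.mulLeft k (x ⊗ₜ[k] y)) := by
      refine tensorFiltration_le fun p' q' hpq' x' hx' y' hy' => ?_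
      simp only [Submodule.mem_comap, LinearMap.mulLeft_apply, Algebra.TensorProduct.tmul_mul_tmul]
      exact tmul_mem_tensorFiltration (by omega) (hF _ _ _ hx _ hx') (hF _ _ _ hy _ hy')
    exact h2 ht
  exact h1 hs

end TensorFiltration

section Antipode

open WithConv LinearMap

variable {k : Type u} {H : Type v} [CommRing k] [Ring H] [Bialgebra k H] {F : ℕ → Submodule k H}

theorem IsFilteredBialgebra.monotone (hF : IsFilteredBialgebra k H F) : Monotone F :=
  monotone_nat_of_le_succ hF.le_succ

theorem IsFilteredBialgebra.convMul_apply_congr (hF : IsFilteredBialgebra k H F) {n : ℕ}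
    {f f' g g' : WithConv (H →ₗ[k] H)}
    (h : ∀ p q, p + q = n → ∀ x ∈ F p, ∀ y ∈ F q, f x * g y = f' x * g' y) {x : H} (hx : x ∈ F n) :
    (f * g) x = (f' * g') x := by
  have h1 : tensorFiltration F n ≤ LinearMap.eqLocus
      (mul' k H ∘ₗ TensorProduct.map f.ofConv g.ofConv)
      (mul' k H ∘ₗ TensorProduct.map f'.ofConv g'.ofConv) :=
    tensorFiltration_le fun p q hpq x hx y hy => by simpa using h p q hpq x hx y hy
  simpa using h1 (hF.comul_mem n x hx)

/-- The endomorphism `u ∘ ε - id`, as an element of the convolution algebra. -/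
noncomputable def convOneSubId (k : Type u) (H : Type v) [CommRing k] [Ring H] [Bialgebra k H] :
    WithConv (H →ₗ[k] H) := 1 - toConv LinearMap.id

theorem IsConnectedFilteredBialgebra.convOneSubId_pow_apply
    (hF : IsConnectedFilteredBialgebra k H F) :
    ∀ {n m : ℕ}, n < m → ∀ {x : H}, x ∈ F n → (convOneSubId k H ^ m) x = 0
  | n, m + 1, h, x, hx => by
    rw [pow_succ']
    have : (convOneSubId k H * convOneSubId k H ^ m) x
        = ((0 : WithConv (H →ₗ[k] H)) * (0 : WithConv (H →ₗ[k] H))) x := by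
      refine hF.toIsFilteredBialgebra.convMul_apply_congr (fun p q hpq x hx y hy => ?_) hx
      rcases Nat.eq_zero_or_pos p with rfl | hp
      · have hx0 : convOneSubId k H x = 0 := by
          rw [hF.connected] at hx
          obtain ⟨c, rfl⟩ := hx
          simp [convOneSubId]
        simp [hx0]
      · have := hF.convOneSubId_pow_apply (n := q) (m := m) (by omega) hy
        simp [this]
    rw [this]; simp

/-- The sum `∑ i, (u ∘ ε - id) ^ i`, evaluated pointwise. -/
theorem IsConnectedFilteredBialgebra.exists_antipode (hF : IsConnectedFilteredBialgebra k H F) :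
    ∃ S : H →ₗ[k] H, toConv S * toConv LinearMap.id = (1 : WithConv (H →ₗ[k] H)) ∧
      toConv LinearMap.id * toConv S = (1 : WithConv (H →ₗ[k] H)) := by
  have hmono := hF.toIsFilteredBialgebra.monotone
  have hfin : ∀ x : H, (Function.support fun i => (convOneSubId k H ^ i) x).Finite := by
    intro x
    obtain ⟨n, hn⟩ := hF.exhaustive x
    refine (Set.finite_Iic n).subset fun i hi => ?_
    by_contra h
    exact hi (hF.convOneSubId_pow_apply (not_le.mp h) hn)
  let S : H →ₗ[k] H :=
    { toFun := fun x => ∑ᶠ i, (convOneSubId k H ^ i) x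
      map_add' := fun x y => by
        simp only [map_add]
        exact finsum_add_distrib (hfin x) (hfin y)
      map_smul' := fun c x => by
        simp only [map_smul, RingHom.id_apply]
        exact (smul_finsum' c (hfin x)).symm }
  have hS : ∀ n p, p ≤ n → ∀ x ∈ F p,
      S x = (∑ i ∈ Finset.range (n + 1), convOneSubId k H ^ i) x := by
    intro n p hpn x hx
    have h1 : S x = ∑ i ∈ Finset.range (n + 1), (convOneSubId k H ^ i) x := by
      refine finsum_eq_sum_of_support_subset _ fun i hi => ?_
      by_contra h
      refine hi (hF.convOneSubId_pow_apply ?_ hx)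
      simp at h; omega
    rw [h1]
    simp [ofConv_sum]
  have hid : toConv LinearMap.id = 1 - convOneSubId k H := by simp [convOneSubId]
  refine ⟨S, ?_, ?_⟩
  · ext x
    obtain ⟨n, hn⟩ := hF.exhaustive x
    have h1 : (toConv S * toConv LinearMap.id : WithConv (H →ₗ[k] H)) x
        = ((∑ i ∈ Finset.range (n + 1), convOneSubId k H ^ i) * toConv LinearMap.id :
            WithConv (H →ₗ[k] H)) x :=
      hF.toIsFilteredBialgebra.convMul_apply_congr (fun p q hpq x hx y hy => by
        rw [← hS n p (by omega) x hx]) hn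
    have h2 := hF.convOneSubId_pow_apply (Nat.lt_succ_self n) hn
    rw [h1, hid, geom_sum_mul_neg, ofConv_sub, LinearMap.sub_apply, h2, sub_zero]
  · ext x
    obtain ⟨n, hn⟩ := hF.exhaustive x
    have h1 : (toConv LinearMap.id * toConv S : WithConv (H →ₗ[k] H)) x
        = (toConv LinearMap.id * (∑ i ∈ Finset.range (n + 1), convOneSubId k H ^ i) :
            WithConv (H →ₗ[k] H)) x :=
      hF.toIsFilteredBialgebra.convMul_apply_congr (fun p q hpq x hx y hy => by
        rw [← hS n q (by omega) y hy]) hn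
    have h2 := hF.convOneSubId_pow_apply (Nat.lt_succ_self n) hn
    rw [h1, hid, mul_neg_geom_sum, ofConv_sub, LinearMap.sub_apply, h2, sub_zero]

end Antipode

namespace FreeERB

section BialgebraStructure

variable {k : Type u} {A : Type v} [CommRing k] [CommRing A]

/-- Two algebra homomorphisms out of `FreeERB k A lam kap` agree if they agree on `A` and intertwine
`P` with the same linear operator. -/
theorem algHom_ext [Algebra k A] {lam kap : k} {R : Type w} [CommRing R] [Algebra k R]
    {f g : FreeERB k A lam kap →ₐ[k] R} (Q : R →ₗ[k] R) (h : ∀ a, f (emb a) = g (emb a))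
    (hf : ∀ x, f (P x) = Q (f x)) (hg : ∀ x, g (P x) = Q (g x)) : f = g := by
  have : f.toLinearMap = g.toLinearMap := by
    refine linearMap_ext fun n x hx => ?_
    induction hx with
    | emb a => exact h a
    | cons n a x hx ih =>
      simp only [AlgHom.toLinearMap_apply] at ih ⊢
      rw [consSum_eq, map_mul, map_mul, h, hf, hg, ih]
  exact AlgHom.toLinearMap_injective this

variable [Bialgebra k A] {lam kap mu : k} (hmu : mu ^ 2 - lam * mu + kap = 0)

theorem counit_emb (a : A) :
    counit (lam := lam) (kap := kap) hmu (emb a) = Coalgebra.counit (R := k) a :=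
  lift_emb _ _ _ a

theorem counit_P (x : FreeERB k A lam kap) : counit hmu (P x) = -mu * counit hmu x :=
  lift_P _ _ _ x

theorem comul_emb (a : A) :
    comul (lam := lam) (kap := kap) hmu (emb a)
      = Algebra.TensorProduct.map emb emb (Coalgebra.comul (R := k) a) :=
  lift_emb _ _ _ a

theorem comul_P (x : FreeERB k A lam kap) : comul hmu (P x) = Pbar hmu (comul hmu x) :=
  lift_P _ _ _ x

theorem counit_left :
    (Algebra.TensorProduct.map (counit (A := A) hmu) (.id k (FreeERB k A lam kap))).comp (comul hmu)
      = (Algebra.TensorProduct.lid k (FreeERB k A lam kap)).symm := by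
  refine algHom_ext (P.lTensor k) (fun a => ?_) (fun x => ?_) fun x => ?_
  · have : ∀ t : A ⊗[k] A,
        Algebra.TensorProduct.map (counit (A := A) hmu) (.id k (FreeERB k A lam kap))
          (Algebra.TensorProduct.map emb emb t)
        = (emb : A →ₐ[k] FreeERB k A lam kap).toLinearMap.lTensor k
            ((Coalgebra.counit (R := k) (A := A)).rTensor A t) := by
      intro t
      induction t using TensorProduct.induction_on with
      | zero => simp
      | add s t hs ht => simp only [map_add, hs, ht]
      | tmul x y => simp [counit_emb]
    simp only [AlgHom.comp_apply, comul_emb, this, Coalgebra.rTensor_counit_comul]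
    simp
  · simp only [AlgHom.comp_apply, comul_P]
    generalize comul hmu x = t
    induction t using TensorProduct.induction_on with
    | zero => simp
    | add s t hs ht => simp only [map_add, hs, ht]
    | tmul a b =>
      simp only [Pbar_tmul, map_add, map_smul, Algebra.TensorProduct.map_tmul, counit_P,
        AlgHom.id_apply, LinearMap.lTensor_tmul, Algebra.algebraMap_eq_smul_one,
        TensorProduct.tmul_smul, TensorProduct.smul_tmul', smul_eq_mul]
      rw [← TensorProduct.add_tmul]
      simp; ring_nf; simp
  · simp

theorem counit_right :
    (Algebra.TensorProduct.map (.id k (FreeERB k A lam kap)) (counit (A := A) hmu)).comp (comul hmu)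
      = (Algebra.TensorProduct.rid k k (FreeERB k A lam kap)).symm := by
  refine algHom_ext (P.rTensor k) (fun a => ?_) (fun x => ?_) fun x => ?_
  · have : ∀ t : A ⊗[k] A,
        Algebra.TensorProduct.map (.id k (FreeERB k A lam kap)) (counit (A := A) hmu)
          (Algebra.TensorProduct.map emb emb t)
        = (emb : A →ₐ[k] FreeERB k A lam kap).toLinearMap.rTensor k
            ((Coalgebra.counit (R := k) (A := A)).lTensor A t) := by
      intro t
      induction t using TensorProduct.induction_on with
      | zero => simp
      | add s t hs ht => simp only [map_add, hs, ht]
      | tmul x y => simp [counit_emb]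
    simp only [AlgHom.comp_apply, comul_emb, this, Coalgebra.lTensor_counit_comul]
    simp
  · simp only [AlgHom.comp_apply, comul_P]
    generalize comul hmu x = t
    induction t using TensorProduct.induction_on with
    | zero => simp
    | add s t hs ht => simp only [map_add, hs, ht]
    | tmul a b =>
      simp [Pbar_tmul, counit_P, TensorProduct.tmul_neg, ← smul_eq_mul, TensorProduct.tmul_smul]
  · simp

/-- The operator on the triple tensor product which corresponds to `P` under the iterated
coproduct. -/
noncomputable def Pbar₃ :
    FreeERB k A lam kap ⊗[k] (FreeERB k A lam kap ⊗[k] FreeERB k A lam kap) →ₗ[k]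
      FreeERB k A lam kap ⊗[k] (FreeERB k A lam kap ⊗[k] FreeERB k A lam kap) :=
  let η : FreeERB k A lam kap →ₗ[k] FreeERB k A lam kap :=
    Algebra.linearMap k _ ∘ₗ (counit hmu).toLinearMap
  TensorProduct.map (P + mu • LinearMap.id) (TensorProduct.map η η)
    + TensorProduct.map LinearMap.id (Pbar hmu)

theorem coassoc :
    (Algebra.TensorProduct.assoc k k k (FreeERB k A lam kap) (FreeERB k A lam kap)
        (FreeERB k A lam kap)).toAlgHom.comp
      ((Algebra.TensorProduct.map (comul hmu) (.id k _)).comp (comul hmu))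
    = (Algebra.TensorProduct.map (.id k _) (comul hmu)).comp (comul hmu) := by
  refine algHom_ext (Pbar₃ hmu) (fun a => ?_) (fun x => ?_) fun x => ?_
  · have h1 : ∀ t : A ⊗[k] A,
        Algebra.TensorProduct.assoc k k k (FreeERB k A lam kap) (FreeERB k A lam kap)
            (FreeERB k A lam kap)
          (Algebra.TensorProduct.map (comul hmu) (.id k _) (Algebra.TensorProduct.map emb emb t))
        = Algebra.TensorProduct.map emb (Algebra.TensorProduct.map emb emb)
            (TensorProduct.assoc k A A A ((Coalgebra.comul (R := k)).rTensor A t)) := by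
      intro t
      induction t using TensorProduct.induction_on with
      | zero => simp
      | add s t hs ht => simp only [map_add, hs, ht]
      | tmul x y =>
        simp only [Algebra.TensorProduct.map_tmul, comul_emb, AlgHom.id_apply,
          LinearMap.rTensor_tmul]
        generalize Coalgebra.comul (R := k) x = t
        induction t using TensorProduct.induction_on with
        | zero => simp
        | add s t hs ht => simp only [map_add, TensorProduct.add_tmul, hs, ht]
        | tmul x z => simp
    have h2 : ∀ t : A ⊗[k] A,
        Algebra.TensorProduct.map (.id k (FreeERB k A lam kap)) (comul hmu)
            (Algebra.TensorProduct.map emb emb t)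
        = Algebra.TensorProduct.map emb (Algebra.TensorProduct.map emb emb)
            ((Coalgebra.comul (R := k)).lTensor A t) := by
      intro t
      induction t using TensorProduct.induction_on with
      | zero => simp
      | add s t hs ht => simp only [map_add, hs, ht]
      | tmul x y => simp [comul_emb]
    have h3 := h1 (Coalgebra.comul (R := k) a)
    rw [Coalgebra.coassoc_apply, ← h2] at h3
    simpa only [AlgHom.comp_apply, comul_emb] using! h3
  · simp only [AlgHom.comp_apply, comul_P]
    generalize comul hmu x = t
    induction t using TensorProduct.induction_on with
    | zero => simp
    | add s t hs ht => simp only [map_add, hs, ht]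
    | tmul a b =>
      simp only [Pbar_tmul, map_add, map_smul, Algebra.TensorProduct.map_tmul, comul_P,
        AlgHom.id_apply]
      generalize comul hmu a = t
      induction t using TensorProduct.induction_on with
      | zero => simp
      | add s t hs ht =>
        simp only [map_add, TensorProduct.add_tmul, smul_add, ← hs, ← ht]
        abel
      | tmul c d =>
        simp [Pbar₃, Pbar_tmul, TensorProduct.add_tmul, TensorProduct.tmul_add,
          Algebra.algebraMap_eq_smul_one, ← TensorProduct.smul_tmul', TensorProduct.tmul_smul]
        module
  · simp only [AlgHom.comp_apply, comul_P]
    generalize comul hmu x = t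
    induction t using TensorProduct.induction_on with
    | zero => simp
    | add s t hs ht => simp only [map_add, hs, ht]
    | tmul a b =>
      have h1 : algebraMap k (FreeERB k A lam kap ⊗[k] FreeERB k A lam kap) (counit hmu b)
          = TensorProduct.map (Algebra.linearMap k _ ∘ₗ (counit hmu).toLinearMap)
              (Algebra.linearMap k _ ∘ₗ (counit hmu).toLinearMap) (comul hmu b) := by
        have h2 : ∀ t : FreeERB k A lam kap ⊗[k] FreeERB k A lam kap,
            TensorProduct.map (Algebra.linearMap k (FreeERB k A lam kap) ∘ₗ (counit hmu).toLinearMap)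
              (Algebra.linearMap k (FreeERB k A lam kap) ∘ₗ (counit hmu).toLinearMap) t
            = algebraMap k _ (counit hmu (Algebra.TensorProduct.lid k _
                (Algebra.TensorProduct.map (counit (A := A) hmu) (.id k _) t))) := by
          intro t
          induction t using TensorProduct.induction_on with
          | zero => simp
          | add s t hs ht => simp only [map_add, hs, ht]
          | tmul x y =>
            simp [Algebra.algebraMap_eq_smul_one, TensorProduct.smul_tmul',
              TensorProduct.tmul_smul, Algebra.TensorProduct.one_def, smul_smul, mul_comm]
        have h3 := DFunLike.congr_fun (counit_left (A := A) hmu) b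
        rw [AlgHom.comp_apply] at h3
        rw [h2, h3]
        simp
      simp only [Pbar_tmul, map_add, map_smul, Algebra.TensorProduct.map_tmul, comul_P,
        AlgHom.id_apply, AlgHom.commutes, h1]
      simp [Pbar₃, TensorProduct.add_tmul, TensorProduct.smul_tmul']

theorem isBialgebraStructure :
    IsBialgebraStructure (comul (A := A) hmu) (counit (A := A) hmu) :=
  ⟨coassoc hmu, counit_left hmu, counit_right hmu⟩

end BialgebraStructure

section FiltrationLemmas

variable {k : Type u} {A : Type v} [CommRing k] [CommRing A] [Algebra k A] {lam kap : k}
  {F : ℕ → Submodule k A}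

/-- The elements which can be written as pure tensors with entries in `F (n 0), …, F (n m)`, where
`n 0 + ⋯ + n m + m = N`. -/
inductive IsPureOfDegree (F : ℕ → Submodule k A) : ℕ → FreeERB k A lam kap → Prop
  | emb {n : ℕ} {a : A} : a ∈ F n → IsPureOfDegree F n (embLin a)
  | cons {n N : ℕ} {a : A} {x : FreeERB k A lam kap} : a ∈ F n → IsPureOfDegree F N x →
      IsPureOfDegree F (n + N + 1) (consSum a x)

theorem deg_le {n : ℕ} {a : A} (ha : a ∈ F n) : deg F a ≤ n := Nat.sInf_le ha

theorem mem_deg (hex : ∀ a : A, ∃ n, a ∈ F n) (a : A) : a ∈ F (deg F a) := Nat.sInf_mem (hex a)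

theorem isPureOfDegree_pure (hex : ∀ a : A, ∃ n, a ∈ F n) :
    ∀ {m : ℕ} (v : Fin (m + 1) → A),
      IsPureOfDegree F ((∑ i, deg F (v i)) + m) (pure v : FreeERB k A lam kap)
  | 0, v => by
    rw [pure_zero]
    simpa using IsPureOfDegree.emb (mem_deg hex (v 0))
  | m + 1, v => by
    rw [pure_succ, Fin.sum_univ_succ, ← add_assoc, add_assoc (deg F (v 0))]
    exact .cons (mem_deg hex _) (isPureOfDegree_pure hex _)

theorem IsPureOfDegree.exists_pure {N : ℕ} {x : FreeERB k A lam kap} (hx : IsPureOfDegree F N x) :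
    ∃ (m : ℕ) (v : Fin (m + 1) → A), (∑ i, deg F (v i)) + m ≤ N ∧ x = pure v := by
  induction hx with
  | @emb n a ha => exact ⟨0, fun _ => a, by simpa using deg_le ha, by rw [pure_zero]⟩
  | @cons n N a x ha hx ih =>
    obtain ⟨m, v, hv, rfl⟩ := ih
    refine ⟨m + 1, Fin.cons a v, ?_, ?_⟩
    · rw [Fin.sum_univ_succ]
      have := deg_le ha
      simp only [Fin.cons_zero, Fin.cons_succ]
      omega
    · rw [pure_succ]; rfl

theorem IsPureOfDegree.mem {N : ℕ} {x : FreeERB k A lam kap} (hx : IsPureOfDegree F N x) :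
    x ∈ filtration lam kap F N :=
  Submodule.subset_span hx.exists_pure

theorem filtration_mono {M N : ℕ} (h : M ≤ N) :
    filtration lam kap F M ≤ filtration lam kap F N :=
  Submodule.span_mono fun _ ⟨m, v, hv, hx⟩ => ⟨m, v, hv.trans h, hx⟩

theorem filtration_le (hex : ∀ a : A, ∃ n, a ∈ F n) {N : ℕ} {M : Submodule k (FreeERB k A lam kap)}
    (h : ∀ n ≤ N, ∀ x, IsPureOfDegree F n x → x ∈ M) : filtration lam kap F N ≤ M := by
  refine Submodule.span_le.mpr ?_
  rintro _ ⟨m, v, hv, rfl⟩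
  exact h _ hv _ (isPureOfDegree_pure hex v)

theorem emb_mem_filtration {n : ℕ} {a : A} (ha : a ∈ F n) :
    (emb a : FreeERB k A lam kap) ∈ filtration lam kap F n :=
  (IsPureOfDegree.emb ha).mem

theorem consSum_mem_filtration (hex : ∀ a : A, ∃ n, a ∈ F n) {n N : ℕ} {a : A} (ha : a ∈ F n)
    {x : FreeERB k A lam kap} (hx : x ∈ filtration lam kap F N) :
    consSum a x ∈ filtration lam kap F (n + N + 1) := by
  have : filtration lam kap F N ≤ (filtration lam kap F (n + N + 1)).comap (consSum a) :=
    filtration_le hex fun m hm y hy => filtration_mono (by omega) (IsPureOfDegree.cons ha hy).mem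
  exact this hx

theorem actSum_mem_filtration (hex : ∀ a : A, ∃ n, a ∈ F n)
    (hmul : ∀ p q, ∀ a ∈ F p, ∀ b ∈ F q, a * b ∈ F (p + q)) {n N : ℕ} {a : A} (ha : a ∈ F n)
    {x : FreeERB k A lam kap} (hx : x ∈ filtration lam kap F N) :
    actSum a x ∈ filtration lam kap F (n + N) := by
  have : filtration lam kap F N ≤ (filtration lam kap F (n + N)).comap (actSum a) := by
    refine filtration_le hex fun m hm y hy => ?_
    rw [Submodule.mem_comap]
    cases hy with
    | emb hb =>
      rw [actSum_embLin]
      exact filtration_mono (by omega) (IsPureOfDegree.emb (hmul _ _ _ ha _ hb)).mem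
    | cons hb hy =>
      rw [actSum_consSum]
      exact filtration_mono (by omega) (IsPureOfDegree.cons (hmul _ _ _ ha _ hb) hy).mem
  exact this hx

theorem P_mem_filtration (hex : ∀ a : A, ∃ n, a ∈ F n) (h1 : (1 : A) ∈ F 0) {N : ℕ}
    {x : FreeERB k A lam kap} (hx : x ∈ filtration lam kap F N) :
    P x ∈ filtration lam kap F (N + 1) := by
  have := consSum_mem_filtration hex h1 hx
  rwa [zero_add] at this

theorem mul_mem_of_isPureOfDegree (hex : ∀ a : A, ∃ n, a ∈ F n) (h1 : (1 : A) ∈ F 0)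
    (hmul : ∀ p q, ∀ a ∈ F p, ∀ b ∈ F q, a * b ∈ F (p + q)) {M N : ℕ}
    {x y : FreeERB k A lam kap} (hx : IsPureOfDegree F M x) (hy : IsPureOfDegree F N y) :
    x * y ∈ filtration lam kap F (M + N) := by
  induction hs : M + N using Nat.strong_induction_on generalizing M N x y with
  | _ s ih =>
  subst hs
  cases hx with
  | @emb _ a ha =>
    change emb a * y ∈ _
    rw [emb_mul]
    exact actSum_mem_filtration hex hmul ha hy.mem
  | @cons p M a x ha hx =>
    cases hy with
    | @emb _ b hb =>
      rw [mul_comm, add_comm]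
      change emb b * _ ∈ _
      rw [emb_mul]
      exact actSum_mem_filtration hex hmul hb (IsPureOfDegree.cons ha hx).mem
    | @cons q N b y hb hy =>
      have hxP : IsPureOfDegree F (0 + M + 1) (consSum 1 x) := .cons h1 hx
      have hyP : IsPureOfDegree F (0 + N + 1) (consSum 1 y) := .cons h1 hy
      have e1 := filtration_mono (N := M + N + 1) (by omega) (ih _ (by omega) hx hyP rfl)
      have e2 := filtration_mono (N := M + N + 1) (by omega) (ih _ (by omega) hxP hy rfl)
      have e3 := ih _ (by omega) hx hy rfl
      have e4 := filtration_mono (Nat.le_succ _) e3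
      rw [consSum_mul_consSum, emb_mul]
      refine add_mem ?_ (Submodule.smul_mem _ _ ?_)
      · exact filtration_mono (by omega) (consSum_mem_filtration hex (hmul _ _ _ ha _ hb)
          (add_mem (add_mem e1 e2) (Submodule.smul_mem _ lam e4)))
      · exact filtration_mono (by omega) (actSum_mem_filtration hex hmul (hmul _ _ _ ha _ hb) e3)

theorem mul_mem_filtration (hex : ∀ a : A, ∃ n, a ∈ F n) (h1 : (1 : A) ∈ F 0)
    (hmul : ∀ p q, ∀ a ∈ F p, ∀ b ∈ F q, a * b ∈ F (p + q)) {M N : ℕ}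
    {x y : FreeERB k A lam kap} (hx : x ∈ filtration lam kap F M)
    (hy : y ∈ filtration lam kap F N) : x * y ∈ filtration lam kap F (M + N) := by
  have h : filtration lam kap F M ≤
      (filtration lam kap F (M + N)).comap (LinearMap.mulRight k y) := by
    refine filtration_le hex fun m hm x hx => ?_
    have h' : filtration lam kap F N ≤
        (filtration lam kap F (M + N)).comap (LinearMap.mulLeft k x) :=
      filtration_le hex fun n hn y hy => filtration_mono (by omega) (mul_mem_of_isPureOfDegree hex h1 hmul hx hy)
    exact h' hy
  exact h hx

theorem exists_mem_filtration (x : FreeERB k A lam kap) : ∃ N, x ∈ filtration lam kap F N := by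
  have h : (⊤ : Submodule k (FreeERB k A lam kap)) ≤ ⨆ N, filtration lam kap F N := by
    have : (⨆ N, filtration lam kap F N).mkQ = 0 := linearMap_ext_pure fun n v => by
      rw [LinearMap.zero_apply, Submodule.mkQ_apply, Submodule.Quotient.mk_eq_zero]
      exact Submodule.mem_iSup_of_mem _ (Submodule.subset_span ⟨n, v, le_rfl, rfl⟩)
    rw [← Submodule.ker_mkQ (⨆ N, filtration lam kap F N), this, LinearMap.ker_zero]
  exact (Submodule.mem_iSup_of_directed _
    (directed_of_isDirected_le fun _ _ => filtration_mono)).mp (h Submodule.mem_top)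

theorem filtration_zero (hex : ∀ a : A, ∃ n, a ∈ F n)
    (h0 : F 0 = LinearMap.range (Algebra.linearMap k A)) :
    filtration lam kap F 0 = LinearMap.range (Algebra.linearMap k (FreeERB k A lam kap)) := by
  have hc : ∀ c : k, (emb (algebraMap k A c) : FreeERB k A lam kap) = algebraMap k _ c :=
    fun c => AlgHom.commutes emb c
  refine le_antisymm (filtration_le hex fun n hn x hx => ?_) ?_
  · cases hx with
    | emb ha =>
      obtain rfl : n = 0 := by omega
      rw [h0] at ha
      obtain ⟨c, rfl⟩ := ha
      exact ⟨c, (hc c).symm⟩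
    | cons => omega
  · rintro _ ⟨c, rfl⟩
    rw [Algebra.linearMap_apply, ← hc]
    exact emb_mem_filtration (h0 ▸ ⟨c, rfl⟩)

end FiltrationLemmas

section FilteredBialgebra

variable {k : Type u} {A : Type v} [CommRing k] [CommRing A] [Bialgebra k A] {lam kap mu : k}
  (hmu : mu ^ 2 - lam * mu + kap = 0) {F : ℕ → Submodule k A}

theorem Pbar_mem_tensorFiltration (hex : ∀ a : A, ∃ n, a ∈ F n) (h1 : (1 : A) ∈ F 0) {N : ℕ}
    {t : FreeERB k A lam kap ⊗[k] FreeERB k A lam kap}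
    (ht : t ∈ tensorFiltration (filtration lam kap F) N) :
    Pbar hmu t ∈ tensorFiltration (filtration lam kap F) (N + 1) := by
  have hone : ∀ (n : ℕ) (c : k), algebraMap k (FreeERB k A lam kap) c ∈ filtration lam kap F n := by
    intro n c
    rw [Algebra.algebraMap_eq_smul_one]
    exact Submodule.smul_mem _ _ (filtration_mono (Nat.zero_le n) (emb_mem_filtration h1))
  have h : tensorFiltration (filtration lam kap F) N ≤
      (tensorFiltration (filtration lam kap F) (N + 1)).comap (Pbar hmu) := by
    refine tensorFiltration_le fun p q hpq x hx y hy => ?_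
    rw [Submodule.mem_comap, Pbar_tmul]
    refine add_mem (add_mem ?_ (Submodule.smul_mem _ _ ?_)) ?_
    · exact tmul_mem_tensorFiltration (by omega) (P_mem_filtration hex h1 hx) (hone q _)
    · exact tmul_mem_tensorFiltration (by omega) hx (hone (q + 1) _)
    · exact tmul_mem_tensorFiltration (by omega) hx (P_mem_filtration hex h1 hy)
  exact h ht

theorem comul_mem_of_isPureOfDegree (hF : IsConnectedFilteredBialgebra k A F) (h1 : (1 : A) ∈ F 0)
    {N : ℕ} {x : FreeERB k A lam kap} (hx : IsPureOfDegree F N x) :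
    comul hmu x ∈ tensorFiltration (filtration lam kap F) N := by
  have hemb : ∀ (n : ℕ) (a : A), a ∈ F n →
      comul (lam := lam) (kap := kap) hmu (emb a) ∈ tensorFiltration (filtration lam kap F) n := by
    intro n a ha
    rw [comul_emb]
    have h : tensorFiltration F n ≤ (tensorFiltration (filtration lam kap F) n).comap
        (Algebra.TensorProduct.map emb emb).toLinearMap := by
      refine tensorFiltration_le fun p q hpq x hx y hy => ?_
      exact tmul_mem_tensorFiltration hpq (emb_mem_filtration hx) (emb_mem_filtration hy)
    exact h (hF.comul_mem n a ha)
  induction hx with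
  | emb ha => exact hemb _ _ ha
  | cons ha _ ih =>
    rw [consSum_eq, map_mul, comul_P, add_assoc]
    exact mul_mem_tensorFiltration
      (fun p q x hx y hy => mul_mem_filtration hF.exhaustive h1 hF.mul_mem hx hy)
      (hemb _ _ ha) (Pbar_mem_tensorFiltration hmu hF.exhaustive h1 ih)

theorem comul_mem_tensorFiltration (hF : IsConnectedFilteredBialgebra k A F) (h1 : (1 : A) ∈ F 0)
    {N : ℕ} {x : FreeERB k A lam kap} (hx : x ∈ filtration lam kap F N) :
    comul hmu x ∈ tensorFiltration (filtration lam kap F) N := by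
  have h : filtration lam kap F N ≤
      (tensorFiltration (filtration lam kap F) N).comap (comul hmu).toLinearMap := by
    refine filtration_le hF.exhaustive fun n hn x hx => ?_
    have hmono : tensorFiltration (filtration lam kap F) n ≤
        tensorFiltration (filtration lam kap F) N :=
      tensorFiltration_le fun p q hpq x hx y hy =>
        tmul_mem_tensorFiltration (p := p) (q := q + (N - n)) (by omega) hx
          (filtration_mono (by omega) hy)
    exact hmono (comul_mem_of_isPureOfDegree hmu hF h1 hx)
  exact h hx

theorem isConnectedFilteredBialgebra_filtration (hF : IsConnectedFilteredBialgebra k A F) :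
    letI : Bialgebra k (FreeERB k A lam kap) := (isBialgebraStructure (A := A) hmu).toBialgebra
    IsConnectedFilteredBialgebra k (FreeERB k A lam kap) (filtration lam kap F) := by
  let : Bialgebra k (FreeERB k A lam kap) := (isBialgebraStructure (A := A) hmu).toBialgebra
  have h1 : (1 : A) ∈ F 0 := by
    rw [hF.connected]
    exact ⟨1, map_one (algebraMap k A)⟩
  have h0 := filtration_zero (lam := lam) (kap := kap) hF.exhaustive hF.connected
  have hrange : ∀ n, LinearMap.range (Algebra.linearMap k (FreeERB k A lam kap))
      ≤ filtration lam kap F n := fun n => h0 ▸ filtration_mono (Nat.zero_le n)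
  exact
    { le_succ := fun n => filtration_mono n.le_succ
      exhaustive := exists_mem_filtration
      mul_mem := fun p q x hx y hy => mul_mem_filtration hF.exhaustive h1 hF.mul_mem hx hy
      comul_mem := fun n x hx => comul_mem_tensorFiltration hmu hF h1 hx
      sup_eq := fun n => by
        refine le_antisymm (sup_le (hrange n) inf_le_left) fun x hx => ?_
        refine Submodule.mem_sup.mpr ⟨algebraMap k _ (Coalgebra.counit x), ⟨_, rfl⟩,
          x - algebraMap k _ (Coalgebra.counit x), ⟨sub_mem hx (hrange n ⟨_, rfl⟩), ?_⟩, by abel⟩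
        simp
      disjoint := fun n => by
        rw [Submodule.disjoint_def]
        rintro _ ⟨c, rfl⟩ ⟨-, hc⟩
        have : c = 0 := by simpa using hc
        rw [this, map_zero]
      connected := h0 }

end FilteredBialgebra

end FreeERB

theorem mainTheorem2 {k : Type u} {A : Type v} [CommRing k] [CommRing A] [Bialgebra k A]
    (F : ℕ → Submodule k A) (hF : IsConnectedFilteredBialgebra k A F)
    (lam kap mu : k) (hmu : mu ^ 2 - lam * mu + kap = 0) :
    ∃ h : IsBialgebraStructure (FreeERB.comul (A := A) hmu) (FreeERB.counit (A := A) hmu),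
      letI : Bialgebra k (FreeERB k A lam kap) := h.toBialgebra
      IsConnectedFilteredBialgebra k (FreeERB k A lam kap) (FreeERB.filtration lam kap F) ∧
        ∃ H : HopfAlgebra k (FreeERB k A lam kap), H.toBialgebra = h.toBialgebra := by
  refine ⟨FreeERB.isBialgebraStructure hmu, ?_⟩
  let : Bialgebra k (FreeERB k A lam kap) :=
    (FreeERB.isBialgebraStructure (A := A) hmu).toBialgebra
  have h := FreeERB.isConnectedFilteredBialgebra_filtration hmu hF
  obtain ⟨S, hS, hS'⟩ := h.exists_antipode
  exact ⟨h, HopfAlgebra.ofConvInverse S hS hS', rfl⟩
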